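/- A \emph{topological graph} is a compact connected metric space that is a union of finitely many arcs (subspaces homeomorphic to $[0,1]$) such that any two distinct arcs intersect at most in common end points. A \emph{transformation group} $(G,X)$ consists of a compact Hausdorff space $X$, a discrete group $G$, and a continuous action $G\times X\to X$ of $G$ on $X$. A subset $Y\subseteq X$ is \emph{invariant} if it is nonempty and $gy\in Y$ for all $g\in G$, $y\in Y$. The \emph{height} $h(G,X)\in\{0,1,2,\ldots\}\cup\{+\infty\}$ is the supremum of all integers $n\ge 0$ for which there exist distinct closed invariant subsets $Y_0\subset Y_1\subset\cdots\subset Y_n=X$. Let $P_h(X)$ denote the set of the heights $h(G,X)$ of all transformation groups $(G,X)$ with phase space $X$. \textbf{Theorem.} For every integer $p\ge 0$ there is a topological graph $\mathcal{G}$ such that \[P_h(\mathcal{G})=\{p,p+1,p+2,\ldots\}\cup\{+\infty\}.\] -/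

import Mathlib

universe u

/-- A topological graph: a compact connected metric space that is a finite union of arcs
(subspaces homeomorphic to `[0,1]`, here the ranges of embeddings `γ i` of `[0,1]`), any two of
which meet at most in common end points. -/
def IsTopologicalGraph (X : Type*) [MetricSpace X] : Prop :=
  CompactSpace X ∧ ConnectedSpace X ∧
    ∃ (n : ℕ) (γ : Fin n → unitInterval → X),
      (∀ i, Topology.IsEmbedding (γ i)) ∧
      (⋃ i, Set.range (γ i)) = Set.univ ∧
      ∀ i j, i ≠ j →
        Set.range (γ i) ∩ Set.range (γ j) ⊆ {γ i 0, γ i 1} ∩ {γ j 0, γ j 1}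

/-- A closed invariant subset of a transformation group `(G, X)`; invariant subsets are
nonempty by convention. -/
def IsClosedInvariant (G : Type*) {X : Type*} [TopologicalSpace X] [Group G] [MulAction G X]
    (Y : Set X) : Prop :=
  Y.Nonempty ∧ IsClosed Y ∧ ∀ g : G, ∀ y ∈ Y, g • y ∈ Y

/-- The height `h(G, Y)` of a closed invariant subset `Y`: the supremum of all `n` for which there
is a chain `Y₀ ⊂ Y₁ ⊂ ⋯ ⊂ Yₙ = Y` of distinct closed invariant subsets. -/
noncomputable def invariantHeight (G : Type*) {X : Type*} [TopologicalSpace X] [Group G]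
    [MulAction G X] (Y : Set X) : ℕ∞ :=
  sSup {h : ℕ∞ | ∃ n : ℕ, h = (n : ℕ∞) ∧ ∃ C : Fin (n + 1) → Set X,
    StrictMono C ∧ (∀ i, IsClosedInvariant G (C i)) ∧ C (Fin.last n) = Y}

/-- `P_h(X)`: the set of the heights `h(G, X)` of all transformation groups `(G, X)` with phase
space `X`, where `G` is a discrete group acting continuously on `X`. Letting `G` range over the
universe of `X` is no restriction: the closed invariant sets of `(G, X)` are those of the image of
`G` in the group of self-homeomorphisms of `X`. -/
def possibleHeights (X : Type u) [TopologicalSpace X] : Set ℕ∞ :=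
  {h | ∃ (G : Type u) (_ : Group G) (_ : TopologicalSpace G) (_ : DiscreteTopology G)
    (_ : MulAction G X) (_ : ContinuousSMul G X), h = invariantHeight G (Set.univ : Set X)}

/-!
Let `X` be a chain of `p + 1` loops, and measure the depth of a point by its horizontal distance to
the nearer end of the chain. The junctions of the loops are the cut points of `X`, and every
self-homeomorphism preserves the way in which a point is separated from them. Hence it preserves
each of the `p + 1` strata where the depth is a given positive integer or lies between two
consecutive integers (the end points counting as part of the first stratum). Those of dimension zero
are closed, and adding the other strata one at a time keeps the union closed, so the height of every
transformation group on `X` is at least `p`.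

Subdividing the first stratum by depth gives `p + 1 + e` strata for any prescribed `e`. The group of
all homeomorphisms that preserve these is transitive on each of them: symmetries of `X` identify the
points of equal depth, and points of different depth are joined by sliding along the loops. As every
closed invariant set is then a union of strata, its height is exactly `p + e`. The trivial group has
infinite height.
-/

open Set Topology

section Height

variable {G X : Type*} [TopologicalSpace X] [Group G] [MulAction G X]

lemma natCast_le_invariantHeight {n : ℕ} {Y : Set X} {C : Fin (n + 1) → Set X}
    (hC : StrictMono C) (hinv : ∀ i, IsClosedInvariant G (C i)) (hlast : C (Fin.last n) = Y) :
    (n : ℕ∞) ≤ invariantHeight G Y :=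
  le_sSup ⟨n, rfl, C, hC, hinv, hlast⟩

/-- The sublevel sets of `c` form a chain of closed invariant sets. -/
lemma encard_range_le_invariantHeight_add_one {α : Type*} [LinearOrder α] {c : X → α}
    (hc : LowerSemicontinuous c) (hinv : ∀ (g : G) (x : X), c (g • x) = c x) :
    (range c).encard ≤ invariantHeight G (univ : Set X) + 1 := by
  refine ENat.forall_natCast_le_iff_le.1 fun k hk => ?_
  obtain _ | n := k
  · simp
  obtain ⟨T, hT, hcard⟩ := exists_subset_encard_eq hk
  have hTfin : T.Finite := finite_of_encard_eq_coe hcard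
  have hTcard : hTfin.toFinset.card = n + 1 := by
    rwa [hTfin.encard_eq_coe_toFinset_card, Nat.cast_inj] at hcard
  let e : Fin (n + 1) ↪o α := hTfin.toFinset.orderEmbOfFin hTcard
  have he (i : Fin (n + 1)) : ∃ x, c x = e i :=
    hT (hTfin.mem_toFinset.1 (Finset.orderEmbOfFin_mem _ hTcard i))
  let C (i : Fin (n + 1)) : Set X := {x | c x ≤ e i ∨ i = Fin.last n}
  have hC : StrictMono C := fun i j hij => by
    obtain ⟨x, hx⟩ := he j
    have hi : i ≠ Fin.last n := (hij.trans_le (Fin.le_last j)).ne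
    refine ⟨fun y hy => .inl ((hy.resolve_right hi).trans (e.monotone hij.le)), fun h => ?_⟩
    have hxi : c x ≤ e i := (h (.inl hx.le)).resolve_right hi
    exact (e.strictMono hij).not_ge (hx ▸ hxi)
  have hclosed (i : Fin (n + 1)) : IsClosed (C i) :=
    (hc.isClosed_preimage (e i)).union isClosed_const
  rw [Nat.cast_succ]
  gcongr
  refine natCast_le_invariantHeight hC (fun i => ⟨?_, hclosed i, fun g x hx => ?_⟩) ?_
  · exact (he i).imp fun x hx => .inl hx.le
  · exact hx.imp_left (hinv g x).le.trans
  · exact eq_univ_of_forall fun x => .inr rfl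

/-- Each step of a chain of invariant sets contains a whole orbit that the earlier steps miss. -/
lemma invariantHeight_add_one_le_encard_range [Nonempty X] {ι : Type*} {c : X → ι}
    (htrans : ∀ x y : X, c x = c y → ∃ g : G, g • x = y) :
    invariantHeight G (univ : Set X) + 1 ≤ (range c).encard := by
  have hone : 1 ≤ (range c).encard := one_le_encard_iff_nonempty.2 (range_nonempty c)
  suffices h : invariantHeight G (univ : Set X) ≤ (range c).encard - 1 from
    (add_le_add_left h 1).trans_eq (tsub_add_cancel_of_le hone)
  refine sSup_le ?_
  rintro _ ⟨n, rfl, C, hC, hinv, -⟩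
  have hfresh (i : Fin (n + 1)) : ∃ x ∈ C i, ∀ j < i, x ∉ C j := by
    rcases Fin.eq_zero_or_eq_succ i with rfl | ⟨j, rfl⟩
    · exact (hinv 0).1.imp fun x hx => ⟨hx, fun j hj => absurd hj (Fin.not_lt_zero j)⟩
    · obtain ⟨x, hx, hxj⟩ := exists_of_ssubset (hC j.castSucc_lt_succ)
      exact ⟨x, hx, fun l hl hxl => hxj (hC.monotone (Fin.le_castSucc_iff.2 hl) hxl)⟩
  choose x hx hxC using hfresh
  have hinj : Function.Injective (c ∘ x) := by
    refine .of_lt_imp_ne fun i j hij hcij => ?_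
    obtain ⟨g, hg⟩ := htrans _ _ hcij
    exact hxC j i hij (hg ▸ (hinv i).2.2 g _ (hx i))
  refine ENat.le_sub_of_add_le_right ENat.one_ne_top ?_
  calc (n : ℕ∞) + 1 = (range (c ∘ x)).encard := by
        rw [← image_univ, hinj.encard_image]; simp [encard_univ]
    _ ≤ (range c).encard := encard_le_encard (range_comp_subset_range x c)

end Height

/-- The tautological action of the group of self-homeomorphisms. -/
instance homeomorphAction (X : Type*) [TopologicalSpace X] : MulAction (X ≃ₜ X) X where
  smul h x := h x
  one_smul _ := rfl
  mul_smul _ _ _ := rfl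

lemma invariantHeight_mem_possibleHeights {X : Type u} [TopologicalSpace X]
    (Γ : Subgroup (X ≃ₜ X)) : invariantHeight Γ (univ : Set X) ∈ possibleHeights X := by
  let _ : TopologicalSpace Γ := ⊥
  have : DiscreteTopology Γ := ⟨rfl⟩
  refine ⟨Γ, inferInstance, inferInstance, inferInstance, inferInstance, ⟨?_⟩, rfl⟩
  exact continuous_prod_of_discrete_left.2 fun g => g.1.continuous

lemma top_mem_possibleHeights {X : Type u} [TopologicalSpace X] {c : X → ℝ} (hc : Continuous c)
    (hinf : (range c).Infinite) : ⊤ ∈ possibleHeights X := by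
  have htriv (g : (⊥ : Subgroup (X ≃ₜ X))) (x : X) : c (g • x) = c x := by
    rw [Subsingleton.elim g 1, one_smul]
  have hle := encard_range_le_invariantHeight_add_one hc.lowerSemicontinuous htriv
  rw [hinf.encard_eq, top_le_iff, ENat.add_eq_top] at hle
  simpa [hle.resolve_right ENat.one_ne_top] using
    invariantHeight_mem_possibleHeights (⊥ : Subgroup (X ≃ₜ X))

/-- The group of the self-homeomorphisms of `X` that preserve every fibre of `c`. -/
def fibrePreserving {X ι : Type*} [TopologicalSpace X] (c : X → ι) : Subgroup (X ≃ₜ X) where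
  carrier := {h | ∀ x, c (h x) = c x}
  mul_mem' hg hh x := (hg _).trans (hh x)
  one_mem' _ := rfl
  inv_mem' {h} hh x := (hh (h.symm x)).symm.trans (congrArg c (h.apply_symm_apply x))

section Slide

lemma exists_homeomorph_real {s t r : ℝ} (h : dist t s < r) :
    ∃ φ : ℝ ≃ₜ ℝ, φ s = t ∧ ∀ u ∉ Metric.ball s r, φ u = u := by
  have hr : 0 < r := dist_nonneg.trans_lt h
  -- The tent `bump` has slopes `±1 / r`, so `f` is increasing as soon as `|t - s| < r`.
  let bump (u : ℝ) : ℝ := max 0 (1 - |u - s| / r)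
  let f (u : ℝ) : ℝ := u + (t - s) * bump u
  have hbump_lip (u v : ℝ) : |bump u - bump v| ≤ |u - v| / r := by
    refine (abs_max_sub_max_le_max _ _ _ _).trans (max_le (by simpa using by positivity) ?_)
    rw [sub_sub_sub_cancel_left, ← sub_div, abs_div, abs_of_pos hr]
    refine div_le_div_of_nonneg_right ?_ hr.le
    calc |(|v - s| - |u - s|)| ≤ |(v - s) - (u - s)| := abs_abs_sub_abs_le _ _
      _ = |u - v| := by rw [sub_sub_sub_cancel_right, abs_sub_comm]
  have hoff (u : ℝ) (hu : u ∉ Metric.ball s r) : f u = u := by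
    rw [Metric.mem_ball, not_lt, Real.dist_eq] at hu
    simp [f, bump, (one_le_div hr).2 hu]
  have hcont : Continuous f := by fun_prop
  have hmono : StrictMono f := fun u v huv => by
    have hlt : |(t - s) * (bump u - bump v)| < v - u := by
      calc |(t - s) * (bump u - bump v)| ≤ |t - s| * (|u - v| / r) := by
            rw [abs_mul]; gcongr; exact hbump_lip u v
        _ = (|t - s| / r) * (v - u) := by rw [abs_sub_comm u, abs_of_pos (sub_pos.2 huv)]; ring
        _ < v - u := mul_lt_of_lt_one_left (sub_pos.2 huv) ((div_lt_one hr).2 h)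
    linarith [le_abs_self ((t - s) * (bump u - bump v))]
  have htop : Filter.Tendsto f Filter.atTop Filter.atTop :=
    Filter.tendsto_id.congr' <| (Filter.eventually_ge_atTop (s + r)).mono fun u hu =>
      (hoff u (by simp [Real.ball_eq_Ioo, hu])).symm
  have hbot : Filter.Tendsto f Filter.atBot Filter.atBot :=
    Filter.tendsto_id.congr' <| (Filter.eventually_le_atBot (s - r)).mono fun u hu =>
      (hoff u (by simp [Real.ball_eq_Ioo, hu.not_gt])).symm
  refine ⟨(hmono.orderIsoOfSurjective f (hcont.surjective htop hbot)).toHomeomorph, ?_, hoff⟩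
  simp [f, bump]

lemma exists_homeomorph_of_isQuotientMap {X Y : Type*} [TopologicalSpace X] [TopologicalSpace Y]
    {f : Y → X} (hf : IsQuotientMap f) (φ : Y ≃ₜ Y)
    (hφ : ∀ x y, f x = f y ↔ f (φ x) = f (φ y)) :
    ∃ h : X ≃ₜ X, ∀ y, h (f y) = f (φ y) := by
  let e : Quotient (Setoid.ker f) ≃ₜ X := IsQuotientMap.homeomorph (f := ⟨f, hf.continuous⟩) hf
  have he (y : Y) : e.symm (f y) = Quotient.mk _ y := e.symm_apply_eq.2 rfl
  refine ⟨e.symm.trans ((Homeomorph.Quotient.congr φ hφ).trans e), fun y => ?_⟩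
  simp only [Homeomorph.trans_apply, he]
  rfl

variable {X : Type*} [TopologicalSpace X] {f : ℝ → X} {U S : Set ℝ} {s t : ℝ}

lemma exists_homeomorph_of_dist_lt (hf : IsQuotientMap f)
    (hinj : ∀ x ∈ U, ∀ y, f x = f y → x = y) {r : ℝ} (hr : Metric.ball s r ⊆ U)
    (ht : dist t s < r) : ∃ h : X ≃ₜ X, h (f s) = f t ∧ ∀ x ∉ f '' U, h x = x := by
  obtain ⟨φ, hφs, hφ⟩ := exists_homeomorph_real ht
  have hoff (u) (hu : u ∉ U) : φ u = u := hφ u fun h => hu (hr h)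
  have hmem {u} (hu : u ∈ U) : φ u ∈ U := by
    by_contra h
    exact h ((φ.injective (hoff _ h)).symm ▸ hu)
  have hker (x y) : f x = f y ↔ f (φ x) = f (φ y) := by
    by_cases hx : x ∈ U
    · exact ⟨fun h => hinj x hx y h ▸ rfl, fun h => φ.injective (hinj _ (hmem hx) _ h) ▸ rfl⟩
    by_cases hy : y ∈ U
    · exact ⟨fun h => hinj y hy x h.symm ▸ rfl,
        fun h => φ.injective (hinj _ (hmem hy) _ h.symm) ▸ rfl⟩
    · rw [hoff x hx, hoff y hy]
  obtain ⟨h, hh⟩ := exists_homeomorph_of_isQuotientMap hf φ hker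
  refine ⟨h, by rw [hh, hφs], fun x hx => ?_⟩
  obtain ⟨u, rfl⟩ := hf.surjective x
  rw [hh, hoff u fun hu => hx ⟨u, hu, rfl⟩]

/-- Being movable to each other is a locally true equivalence relation on `S`. -/
lemma exists_homeomorph_of_isPreconnected (hf : IsQuotientMap f) (hU : IsOpen U)
    (hinj : ∀ x ∈ U, ∀ y, f x = f y → x = y) (hS : IsPreconnected S) (hSU : S ⊆ U)
    (hs : s ∈ S) (ht : t ∈ S) : ∃ h : X ≃ₜ X, h (f s) = f t ∧ ∀ x ∉ f '' U, h x = x := by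
  refine hS.induction₂ (fun s t => ∃ h : X ≃ₜ X, h (f s) = f t ∧ ∀ x ∉ f '' U, h x = x)
    (fun s hs => ?_) ?_ ?_ hs ht
  · obtain ⟨r, hr, hball⟩ := Metric.isOpen_iff.1 hU s (hSU hs)
    filter_upwards [mem_nhdsWithin_of_mem_nhds (Metric.ball_mem_nhds s hr)] with t ht
    exact exists_homeomorph_of_dist_lt hf hinj hball ht
  · rintro s t u - - - ⟨g, hg, hgU⟩ ⟨h, hh, hhU⟩
    exact ⟨g.trans h, by simp [hg, hh], fun x hx => by simp [hgU x hx, hhU x hx]⟩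
  · rintro s t - - ⟨h, hh, hhU⟩
    exact ⟨h.symm, by simp [← hh], fun x hx => h.symm_apply_eq.2 (hhU x hx).symm⟩

end Slide

section Stratum

/-- The index of the stratum of `t` in the decomposition of the line into the integers and the open
intervals between them: `2 * m` for the integer `m`, and `2 * m + 1` for the interval between `m`
and `m + 1`. -/
noncomputable def stratum (t : ℝ) : ℤ := ⌊t⌋ + ⌈t⌉

lemma monotone_stratum : Monotone stratum := fun _ _ h =>
  add_le_add (Int.floor_mono h) (Int.ceil_mono h)

lemma stratum_intCast (m : ℤ) : stratum m = 2 * m := by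
  rw [stratum, Int.floor_intCast, Int.ceil_intCast, two_mul]

lemma stratum_of_mem_Ioo {m : ℤ} {t : ℝ} (ht : t ∈ Ioo (m : ℝ) (m + 1)) :
    stratum t = 2 * m + 1 := by
  have hfloor : ⌊t⌋ = m := Int.floor_eq_iff.2 ⟨ht.1.le, ht.2⟩
  have hceil : ⌈t⌉ = m + 1 := Int.ceil_eq_iff.2 (by push_cast; simpa using ⟨ht.1, ht.2.le⟩)
  rw [stratum, hfloor, hceil]
  ring

lemma eq_intCast_or_mem_Ioo_floor (t : ℝ) : t = ⌊t⌋ ∨ t ∈ Ioo (⌊t⌋ : ℝ) (⌊t⌋ + 1) :=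
  (Int.floor_le t).eq_or_lt.imp Eq.symm fun h => ⟨h, Int.lt_floor_add_one t⟩

lemma eq_intCast_or_mem_Ioo_of_stratum_eq {s t : ℝ} (h : stratum s = stratum t) :
    ∃ m : ℤ, (s = m ∧ t = m) ∨ (s ∈ Ioo (m : ℝ) (m + 1) ∧ t ∈ Ioo (m : ℝ) (m + 1)) := by
  have hrank (u : ℝ) : (u = ⌊u⌋ ∧ stratum u = 2 * ⌊u⌋) ∨
      (u ∈ Ioo (⌊u⌋ : ℝ) (⌊u⌋ + 1) ∧ stratum u = 2 * ⌊u⌋ + 1) :=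
    (eq_intCast_or_mem_Ioo_floor u).imp
      (fun hu => ⟨hu, (congrArg stratum hu).trans (stratum_intCast _)⟩)
      fun hu => ⟨hu, stratum_of_mem_Ioo hu⟩
  have hs := hrank s
  have ht := hrank t
  have hfloor : ⌊s⌋ = ⌊t⌋ := by omega
  rw [hfloor] at hs
  refine ⟨⌊t⌋, ?_⟩
  rcases hs with hs | hs <;> rcases ht with ht | ht
  · exact .inl ⟨hs.1, ht.1⟩
  · omega
  · omega
  · exact .inr ⟨hs.1, ht.1⟩

lemma stratum_congr {s t : ℝ} (hlt : ∀ m : ℤ, s < m ↔ t < m) (hle : ∀ m : ℤ, s ≤ m ↔ t ≤ m) :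
    stratum s = stratum t := by
  have hfloor : ⌊s⌋ = ⌊t⌋ := eq_of_forall_gt_iff fun m => by simp only [Int.floor_lt, hlt]
  have hceil : ⌈s⌉ = ⌈t⌉ := eq_of_forall_ge_iff fun m => by simp only [Int.ceil_le, hle]
  rw [stratum, hfloor, hceil, stratum]

lemma stratum_intCast_div_two (z : ℤ) : stratum (z / 2) = z := by
  rcases Int.even_or_odd' z with ⟨m, rfl | rfl⟩
  · refine (congrArg stratum ?_).trans (stratum_intCast m)
    push_cast
    ring
  · refine stratum_of_mem_Ioo ?_
    push_cast
    constructor <;> linarith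

lemma stratum_image_Icc (a b : ℤ) : stratum '' Icc (a / 2 : ℝ) (b / 2) = Icc a b := by
  refine Subset.antisymm ?_ fun z hz => ⟨z / 2, ?_, stratum_intCast_div_two z⟩
  · exact monotone_stratum.image_Icc_subset.trans_eq (by simp only [stratum_intCast_div_two])
  · have ha : (a : ℝ) ≤ z := mod_cast hz.1
    have hb : (z : ℝ) ≤ b := mod_cast hz.2
    exact ⟨by gcongr, by gcongr⟩

/-- The zero-dimensional strata are closed, and the closure of a one-dimensional stratum adds only
zero-dimensional ones. -/
lemma lowerSemicontinuous_stratum :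
    LowerSemicontinuous fun t : ℝ => toLex (stratum t % 2, stratum t) := by
  refine fun t k hk => ?_
  have hnhds : Ioo (⌈t⌉ - 1 : ℝ) (⌊t⌋ + 1) ∈ 𝓝 t :=
    Ioo_mem_nhds (by linarith [Int.ceil_lt_add_one t]) (Int.lt_floor_add_one t)
  filter_upwards [hnhds] with s hs
  refine hk.trans_le (Prod.Lex.toLex_le_toLex.2 ?_)
  have hceil : ⌈t⌉ ≤ ⌈s⌉ := Int.sub_one_lt_iff.1 (Int.lt_ceil.2 (mod_cast hs.1))
  have hfloor : ⌊s⌋ ≤ ⌊t⌋ := Int.lt_add_one_iff.1 (Int.floor_lt.2 (mod_cast hs.2))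
  have hs' := Int.ceil_le_floor_add_one s
  have ht' := Int.floor_le_ceil t
  simp only [stratum]
  omega

lemma encard_range_stratum_le_invariantHeight_add_one {G X : Type*} [TopologicalSpace X] [Group G]
    [MulAction G X] {d : X → ℝ} (hd : Continuous d)
    (hinv : ∀ (g : G) (x : X), stratum (d (g • x)) = stratum (d x)) :
    (range (stratum ∘ d)).encard ≤ invariantHeight G (univ : Set X) + 1 := by
  have hkey : Function.Injective fun k : ℤ => toLex (k % 2, k) := fun _ _ h =>
    congrArg (fun q => (ofLex q).2) h
  rw [← hkey.encard_image, ← range_comp]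
  exact encard_range_le_invariantHeight_add_one (lowerSemicontinuous_stratum.comp hd)
    fun g x => by simp only [Function.comp_apply, hinv]

/-- The monotone map of the line that fixes `[1/2, ∞)` and stretches the part below `1/2` by the
factor `e`, so that the image of `[0, 1/2]` meets `e + 1` strata. -/
noncomputable def rescale (e : ℕ) (s : ℝ) : ℝ := max s (1 / 2) - e * max 0 (1 / 2 - s)

variable {e : ℕ}

lemma continuous_rescale (e : ℕ) : Continuous (rescale e) := by
  unfold rescale
  fun_prop

lemma monotone_rescale (e : ℕ) : Monotone (rescale e) := fun s t hst => by
  unfold rescale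
  gcongr

lemma rescale_zero_left (s : ℝ) : rescale 0 s = max s (1 / 2) := by simp [rescale]

lemma rescale_of_ge {s : ℝ} (hs : 1 / 2 ≤ s) : rescale e s = s := by
  rw [rescale, max_eq_left hs, max_eq_left (sub_nonpos.2 hs), mul_zero, sub_zero]

lemma rescale_of_le {s : ℝ} (hs : s ≤ 1 / 2) : rescale e s = 1 / 2 - e * (1 / 2 - s) := by
  rw [rescale, max_eq_right hs, max_eq_right (sub_nonneg.2 hs)]

lemma rescale_image_Icc (e : ℕ) {b : ℝ} (hb : 1 / 2 ≤ b) :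
    rescale e '' Icc 0 b = Icc ((1 - e) / 2 : ℝ) b := by
  rw [(continuous_rescale e).continuousOn.image_Icc_of_monotoneOn (by linarith)
    ((monotone_rescale e).monotoneOn _), rescale_of_le (by norm_num), rescale_of_ge hb]
  ring_nf

lemma eq_of_rescale_eq {s t : ℝ} (h : rescale e s = rescale e t) (hne : rescale e t ≠ 1 / 2) :
    s = t := by
  have hhalf : rescale e (1 / 2) = 1 / 2 := rescale_of_ge le_rfl
  have hside {u v : ℝ} (hu : u ≤ 1 / 2) (hv : 1 / 2 ≤ v) (huv : rescale e u = rescale e v) :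
      rescale e u = 1 / 2 :=
    hhalf ▸ (monotone_rescale e hu).antisymm ((monotone_rescale e hv).trans_eq huv.symm)
  rcases le_total s (1 / 2) with hs | hs <;> rcases le_total t (1 / 2) with ht | ht
  · rw [rescale_of_le ht] at hne
    rw [rescale_of_le hs, rescale_of_le ht] at h
    have he : (e : ℝ) ≠ 0 := fun he => hne (by rw [he]; ring)
    exact sub_right_injective (mul_left_cancel₀ he (sub_right_injective h))
  · exact absurd (h ▸ hside hs ht h) hne
  · exact absurd (hside ht hs h.symm) hne
  · rwa [rescale_of_ge hs, rescale_of_ge ht] at h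

end Stratum

section CutPoints

/-- The cut points of a connected space `X`: the points whose removal disconnects it. -/
def cutPoints (X : Type*) [TopologicalSpace X] : Set X := {x | ¬ IsPreconnected {x}ᶜ}

/-- The number of cut points of `X` on the same side of `v` as `x`. -/
noncomputable def cutCount {X : Type*} [TopologicalSpace X] (v x : X) : ℕ :=
  (cutPoints X ∩ connectedComponentIn {v}ᶜ x).ncard

/-- The points that some cut point of `X` separates from all but fewer than `m` other cut
points. -/
def cutRegion (X : Type*) [TopologicalSpace X] (m : ℤ) : Set X :=
  {x | ∃ v ∈ cutPoints X, x ≠ v ∧ cutCount v x < m}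

variable {X Y : Type*} [TopologicalSpace X] [TopologicalSpace Y] (h : X ≃ₜ Y)

lemma apply_mem_cutPoints_iff {x : X} : h x ∈ cutPoints Y ↔ x ∈ cutPoints X := by
  rw [cutPoints, mem_ofPred_eq, ← image_singleton, ← image_compl_eq h.bijective,
    h.isPreconnected_image, cutPoints, mem_ofPred_eq]

lemma image_cutPoints : h '' cutPoints X = cutPoints Y := by
  ext y
  obtain ⟨x, rfl⟩ := h.surjective y
  rw [h.injective.mem_set_image, apply_mem_cutPoints_iff]

lemma cutCount_apply {v x : X} (hxv : x ≠ v) : cutCount (h v) (h x) = cutCount v x := by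
  rw [cutCount, ← image_singleton, ← image_compl_eq h.bijective,
    ← h.image_connectedComponentIn (by simpa), ← image_cutPoints h, ← image_inter h.injective,
    h.injective.injOn.ncard_image, cutCount]

lemma apply_mem_cutRegion {m : ℤ} {x : X} : x ∈ cutRegion X m → h x ∈ cutRegion Y m :=
  fun ⟨v, hv, hxv, hcount⟩ =>
    ⟨h v, (apply_mem_cutPoints_iff h).2 hv, h.injective.ne hxv,
      (cutCount_apply h hxv).symm ▸ hcount⟩

lemma apply_mem_cutRegion_iff {m : ℤ} {x : X} : h x ∈ cutRegion Y m ↔ x ∈ cutRegion X m :=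
  ⟨fun hx => h.symm_apply_apply x ▸ apply_mem_cutRegion h.symm hx, apply_mem_cutRegion h⟩

variable {f : X → ℝ} {a : ℝ} {S : Set X} {x y : X}

lemma lt_of_isPreconnected (hf : Continuous f) (hS : IsPreconnected S) (ha : ∀ z ∈ S, f z ≠ a)
    (hx : x ∈ S) (hy : y ∈ S) (hlt : f x < a) : f y < a := by
  by_contra! hle
  obtain ⟨z, hz, rfl⟩ := hS.intermediate_value hx hy hf.continuousOn ⟨hlt.le, hle⟩
  exact ha z hz rfl

lemma connectedComponentIn_eq_setOf_lt (hf : Continuous f) (ha : ∀ z ∈ S, f z ≠ a)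
    (hS : {z | f z < a} ⊆ S) (hconn : IsPreconnected {z | f z < a}) (hx : f x < a) :
    connectedComponentIn S x = {z | f z < a} := by
  refine Subset.antisymm (fun y hy => ?_) (hconn.subset_connectedComponentIn hx hS)
  exact lt_of_isPreconnected hf isPreconnected_connectedComponentIn
    (fun z hz => ha z (connectedComponentIn_subset S x hz)) (mem_connectedComponentIn (hS hx)) hy hx

end CutPoints

/-- A chain of `n` loops in the plane, consecutive ones touching at a point of the axis. -/
def necklace (n : ℕ) : Set (ℝ × ℝ) :=
  {q | 0 ≤ q.1 ∧ q.1 ≤ n ∧ q.2 ^ 2 = Real.sin (Real.pi * q.1) ^ 2}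

namespace necklace

variable {n : ℕ}

section Curve

/-- The closed curve that runs along the graph of `x ↦ -sin (π x)` from right to left for
`u ∈ [-n, 0]` and back along that of `x ↦ sin (π x)` for `u ∈ [0, n]`; other parameters are clamped
to `[-n, n]`. -/
noncomputable def curve (n : ℕ) (u : ℝ) : necklace n :=
  let v : Icc (-n : ℝ) n := projIcc (-n : ℝ) n (neg_le_self n.cast_nonneg) u
  ⟨(|v|, Real.sin (Real.pi * v)), abs_nonneg _, abs_le.2 v.2, by
    rcases abs_choice (v : ℝ) with h | h <;> simp [h, mul_neg, Real.sin_neg]⟩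

lemma continuous_curve (n : ℕ) : Continuous (curve n) := by
  have : Continuous fun u => (projIcc (-n : ℝ) n (neg_le_self n.cast_nonneg) u : ℝ) :=
    continuous_subtype_val.comp continuous_projIcc
  exact Continuous.subtype_mk (by fun_prop) _

lemma curve_val {u : ℝ} (hu : |u| ≤ n) : (curve n u).1 = (|u|, Real.sin (Real.pi * u)) := by
  simp only [curve, projIcc_of_mem _ (abs_le.1 hu)]

lemma curve_fst {u : ℝ} (hu : |u| ≤ n) : (curve n u).1.1 = |u| := by rw [curve_val hu]

lemma exists_abs_le_curve_eq_curve (u : ℝ) :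
    ∃ v : ℝ, |v| ≤ n ∧ curve n u = curve n v ∧ (|v| < n → u = v) := by
  have hn : (-n : ℝ) ≤ n := neg_le_self n.cast_nonneg
  refine ⟨projIcc (-n : ℝ) n hn u, abs_le.2 (projIcc _ _ hn u).2, ?_, fun h => ?_⟩
  · simp only [curve, projIcc_val]
  · rw [coe_projIcc] at h ⊢
    grind

lemma exists_curve_eq (Q : necklace n) : ∃ u, |u| = Q.1.1 ∧ curve n u = Q := by
  obtain ⟨⟨x, y⟩, h0 : 0 ≤ x, hn : x ≤ n, hy⟩ := Q
  have hx : |x| = x := abs_of_nonneg h0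
  rcases sq_eq_sq_iff_eq_or_eq_neg.1 hy with h | h
  · exact ⟨x, hx, Subtype.ext ((curve_val (hx.trans_le hn)).trans (Prod.ext hx h.symm))⟩
  · have hx' : |-x| = x := (abs_neg x).trans hx
    refine ⟨-x, hx', Subtype.ext ((curve_val (hx'.trans_le hn)).trans (Prod.ext hx' ?_))⟩
    simpa [mul_neg, Real.sin_neg] using h.symm

lemma curve_eq_curve_iff {u v : ℝ} (hu : |u| ≤ n) (hv : |v| ≤ n) :
    curve n u = curve n v ↔ u = v ∨ (u = -v ∧ ∃ m : ℤ, u = m) := by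
  have hsin (w : ℝ) : Real.sin (Real.pi * -w) = Real.sin (Real.pi * w) ↔ ∃ m : ℤ, -w = m := by
    rw [mul_neg, Real.sin_neg, neg_eq_self, ← neg_eq_zero, ← Real.sin_neg, ← mul_neg,
      Real.sin_eq_zero_iff]
    simp only [mul_comm Real.pi, mul_eq_mul_right_iff, Real.pi_ne_zero, or_false, eq_comm]
  rw [Subtype.ext_iff, curve_val hu, curve_val hv, Prod.mk.injEq, abs_eq_abs]
  constructor
  · rintro ⟨rfl | rfl, h⟩
    · exact .inl rfl
    · exact .inr ⟨rfl, (hsin v).1 h⟩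
  · rintro (rfl | ⟨rfl, h⟩)
    · exact ⟨.inl rfl, rfl⟩
    · exact ⟨.inr rfl, (hsin v).2 h⟩

lemma curve_neg {m : ℤ} (hm : |(m : ℝ)| ≤ n) : curve n (-m) = curve n m :=
  (curve_eq_curve_iff (by rwa [abs_neg]) hm).2 (.inr ⟨rfl, -m, by push_cast; rfl⟩)

lemma curve_image_Icc : curve n '' Icc (-n : ℝ) n = univ := by
  refine eq_univ_of_forall fun Q => ?_
  obtain ⟨u, hu, rfl⟩ := exists_curve_eq Q
  exact ⟨u, abs_le.1 (hu.trans_le (curve n u).2.2.1), rfl⟩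

instance : CompactSpace (necklace n) :=
  ⟨curve_image_Icc ▸ isCompact_Icc.image (continuous_curve n)⟩

instance : ConnectedSpace (necklace n) :=
  connectedSpace_iff_univ.2 <| curve_image_Icc ▸
    (isConnected_Icc (neg_le_self n.cast_nonneg)).image _ (continuous_curve n).continuousOn

lemma isQuotientMap_curve (n : ℕ) : IsQuotientMap (curve n) := by
  have hcont : Continuous (curve n ∘ ((↑) : Icc (-n : ℝ) n → ℝ)) :=
    (continuous_curve n).comp continuous_subtype_val
  refine .of_comp continuous_subtype_val (continuous_curve n)
    (hcont.isClosedMap.isQuotientMap hcont ?_)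
  rw [← range_eq_univ, range_comp, Subtype.range_coe, curve_image_Icc]

end Curve

section Arc

/-- The arc of the necklace that `curve` traces between the integers `i - n` and `i - n + 1`. -/
noncomputable def arc (i : Fin (2 * n)) (t : unitInterval) : necklace n := curve n (i - n + t)

lemma abs_arc_parameter_le (i : Fin (2 * n)) (t : unitInterval) : |(i - n + t : ℝ)| ≤ n := by
  have hi : (i : ℝ) + 1 ≤ 2 * n := mod_cast i.2
  exact abs_le.2 ⟨by linarith [t.2.1, (i : ℕ).cast_nonneg (α := ℝ)], by linarith [t.2.2]⟩

lemma arc_eq_arc_iff {i j : Fin (2 * n)} {s t : unitInterval} :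
    arc i s = arc j t ↔ (i + s : ℝ) = j + t ∨
      ((i - n + s : ℝ) = -(j - n + t) ∧ ∃ m : ℤ, (i - n + s : ℝ) = m) := by
  rw [arc, arc, curve_eq_curve_iff (abs_arc_parameter_le i s) (abs_arc_parameter_le j t)]
  simp only [sub_add_eq_add_sub, sub_left_inj]

lemma eq_zero_or_one_of_eq_intCast {s : unitInterval} {m : ℤ} (h : (s : ℝ) = m) :
    s = 0 ∨ s = 1 := by
  have h0 : (0 : ℝ) ≤ m := h ▸ s.2.1
  have h1 : (m : ℝ) ≤ 1 := h ▸ s.2.2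
  norm_cast at h0 h1
  obtain rfl | rfl : m = 0 ∨ m = 1 := by omega
  · exact .inl (Subtype.ext (by simpa using h))
  · exact .inr (Subtype.ext (by simpa using h))

lemma isEmbedding_arc (i : Fin (2 * n)) : IsEmbedding (arc i) := by
  have hcont : Continuous (arc i) := (continuous_curve n).comp (by fun_prop)
  refine (hcont.isClosedEmbedding fun s t h => ?_).isEmbedding
  rcases arc_eq_arc_iff.1 h with h | ⟨h, m, hm⟩
  · exact Subtype.ext (add_left_cancel h)
  have hst : (s : ℝ) - t = 2 * m := by linarith
  have hlow : (-1 : ℝ) ≤ 2 * m := by linarith [s.2.1, t.2.2]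
  have hupp : 2 * m ≤ (1 : ℝ) := by linarith [s.2.2, t.2.1]
  norm_cast at hlow hupp
  obtain rfl : m = 0 := by omega
  exact Subtype.ext (by simpa [sub_eq_zero] using hst)

lemma eq_zero_or_one_of_arc_eq_arc {i j : Fin (2 * n)} (hij : i ≠ j) {s t : unitInterval}
    (h : arc i s = arc j t) : s = 0 ∨ s = 1 := by
  rcases arc_eq_arc_iff.1 h with h | ⟨-, m, hm⟩
  · rcases hij.lt_or_gt with hlt | hlt
    · have hij' : (i : ℝ) + 1 ≤ j := mod_cast hlt
      exact .inr (Subtype.ext (s.2.2.antisymm (by linarith [t.2.1])))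
    · have hji' : (j : ℝ) + 1 ≤ i := mod_cast hlt
      exact .inl (Subtype.ext (s.2.1.antisymm' (by linarith [t.2.2])))
  · exact eq_zero_or_one_of_eq_intCast (m := m - i + n) (by push_cast; linarith)

lemma iUnion_range_arc (hn : 0 < n) : ⋃ i : Fin (2 * n), range (arc i) = univ := by
  refine eq_univ_of_forall fun Q => mem_iUnion.2 ?_
  obtain ⟨u, hu, rfl⟩ : Q ∈ curve n '' Icc (-n : ℝ) n := curve_image_Icc ▸ mem_univ Q
  rcases hu.2.eq_or_lt with rfl | hlt
  · refine ⟨⟨0, by omega⟩, 0, ?_⟩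
    simpa [arc] using curve_neg (n := n) (m := n) (by simp)
  · have h0 : 0 ≤ u + n := by linarith [hu.1]
    refine ⟨⟨⌊u + n⌋₊, (Nat.floor_lt h0).2 (by push_cast; linarith)⟩,
      ⟨u + n - ⌊u + n⌋₊, ?_, ?_⟩, ?_⟩
    · exact sub_nonneg.2 (Nat.floor_le h0)
    · linarith [Nat.lt_floor_add_one (u + n)]
    · rw [arc]
      congr 1
      push_cast
      ring

lemma isTopologicalGraph (hn : 0 < n) : IsTopologicalGraph (necklace n) := by
  refine ⟨inferInstance, inferInstance, 2 * n, arc, isEmbedding_arc, iUnion_range_arc hn, ?_⟩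
  rintro i j hij _ ⟨⟨s, rfl⟩, ⟨t, hst⟩⟩
  have hends {k : Fin (2 * n)} {r : unitInterval} (hr : r = 0 ∨ r = 1) :
      arc k r ∈ ({arc k 0, arc k 1} : Set (necklace n)) := by
    rcases hr with rfl | rfl <;> simp
  exact ⟨hends (eq_zero_or_one_of_arc_eq_arc hij hst.symm),
    hst ▸ hends (eq_zero_or_one_of_arc_eq_arc hij.symm hst)⟩

end Arc

section Depth

lemma continuous_fst_val : Continuous fun Q : necklace n => Q.1.1 :=
  continuous_fst.comp continuous_subtype_val

/-- The horizontal distance of a point of the necklace to the nearer one of the two ends. -/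
def depth (Q : necklace n) : ℝ := min Q.1.1 (n - Q.1.1)

lemma continuous_depth : Continuous (depth : necklace n → ℝ) :=
  continuous_fst_val.min (continuous_const.sub continuous_fst_val)

lemma depth_mem_Icc (Q : necklace n) : depth Q ∈ Icc (0 : ℝ) (n / 2) := by
  refine ⟨le_min Q.2.1 (sub_nonneg.2 Q.2.2.1), ?_⟩
  rcases le_total Q.1.1 (n / 2) with h | h
  · exact min_le_of_left_le h
  · exact min_le_of_right_le (by linarith)

lemma depth_curve {u : ℝ} (hu : |u| ≤ n) : depth (curve n u) = min |u| (n - |u|) := by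
  rw [depth, curve_fst hu]

lemma depth_curve_of_mem_Icc {s : ℝ} (hs : s ∈ Icc (0 : ℝ) (n / 2)) : depth (curve n s) = s := by
  have habs : |s| = s := abs_of_nonneg hs.1
  have : (0 : ℝ) ≤ n := n.cast_nonneg
  rw [depth_curve (by linarith [hs.2]), habs, min_eq_left (by linarith [hs.2])]

lemma range_depth (n : ℕ) : range (depth : necklace n → ℝ) = Icc (0 : ℝ) (n / 2) :=
  (range_subset_iff.2 depth_mem_Icc).antisymm fun _ hs => ⟨_, depth_curve_of_mem_Icc hs⟩

/-- The reflection of the necklace in its axis. -/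
def flip (n : ℕ) : necklace n ≃ₜ necklace n where
  toFun Q := ⟨(Q.1.1, -Q.1.2), Q.2.1, Q.2.2.1, by simpa using Q.2.2.2⟩
  invFun Q := ⟨(Q.1.1, -Q.1.2), Q.2.1, Q.2.2.1, by simpa using Q.2.2.2⟩
  left_inv Q := by simp
  right_inv Q := by simp
  continuous_toFun := Continuous.subtype_mk (by fun_prop) _
  continuous_invFun := Continuous.subtype_mk (by fun_prop) _

lemma sin_sq_pi_mul_natCast_sub (n : ℕ) (x : ℝ) :
    Real.sin (Real.pi * (n - x)) ^ 2 = Real.sin (Real.pi * x) ^ 2 := by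
  rw [mul_sub, mul_comm Real.pi n, Real.sin_nat_mul_pi_sub, neg_sq, mul_pow, ← pow_mul, mul_comm n,
    pow_mul, neg_one_sq, one_pow, one_mul]

/-- The reflection of the necklace that swaps its two ends. -/
def mirror (n : ℕ) : necklace n ≃ₜ necklace n where
  toFun Q := ⟨(n - Q.1.1, Q.1.2), sub_nonneg.2 Q.2.2.1, sub_le_self _ Q.2.1,
    (sin_sq_pi_mul_natCast_sub n _).symm ▸ Q.2.2.2⟩
  invFun Q := ⟨(n - Q.1.1, Q.1.2), sub_nonneg.2 Q.2.2.1, sub_le_self _ Q.2.1,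
    (sin_sq_pi_mul_natCast_sub n _).symm ▸ Q.2.2.2⟩
  left_inv Q := by simp
  right_inv Q := by simp
  continuous_toFun := Continuous.subtype_mk (by fun_prop) _
  continuous_invFun := Continuous.subtype_mk (by fun_prop) _

lemma mirror_fst (Q : necklace n) : (mirror n Q).1.1 = n - Q.1.1 := rfl

lemma flip_mem_fibrePreserving_depth (n : ℕ) :
    flip n ∈ fibrePreserving (depth : necklace n → ℝ) := fun _ => rfl

lemma mirror_mem_fibrePreserving_depth (n : ℕ) :
    mirror n ∈ fibrePreserving (depth : necklace n → ℝ) := fun Q => by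
  rw [depth, depth, mirror_fst, sub_sub_cancel, min_comm]

lemma eq_or_eq_flip_of_fst_eq {P Q : necklace n} (h : P.1.1 = Q.1.1) : P = Q ∨ P = flip n Q := by
  have hsq : P.1.2 ^ 2 = Q.1.2 ^ 2 := by rw [P.2.2.2, Q.2.2.2, h]
  exact (sq_eq_sq_iff_eq_or_eq_neg.1 hsq).imp
    (fun h' => Subtype.ext (Prod.ext h h')) fun h' => Subtype.ext (Prod.ext h h')

lemma exists_fibrePreserving_depth {P Q : necklace n} (h : depth P = depth Q) :
    ∃ g ∈ fibrePreserving (depth : necklace n → ℝ), g P = Q := by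
  have hfst {R : necklace n} (hR : R.1.1 = Q.1.1) :
      ∃ g ∈ fibrePreserving (depth : necklace n → ℝ), g R = Q := by
    rcases eq_or_eq_flip_of_fst_eq hR.symm with hQ | hQ
    · exact ⟨1, one_mem _, hQ.symm⟩
    · exact ⟨flip n, flip_mem_fibrePreserving_depth n, hQ.symm⟩
  by_cases hPQ : P.1.1 = Q.1.1
  · exact hfst hPQ
  · have hmirror : (mirror n P).1.1 = Q.1.1 := by
      rw [mirror_fst]
      simp only [depth, min_def] at h
      split_ifs at h <;> first | exact absurd (by linarith) hPQ | linarith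
    obtain ⟨g, hg, hgP⟩ := hfst hmirror
    exact ⟨g * mirror n, mul_mem hg (mirror_mem_fibrePreserving_depth n), hgP⟩

end Depth

section Cut

lemma eq_of_fst_eq_intCast {P Q : necklace n} {m : ℤ} (hP : P.1.1 = m) (hQ : Q.1.1 = m) :
    P = Q := by
  have haxis {R : necklace n} (hR : R.1.1 = m) : R.1.2 = 0 := by
    rw [← pow_eq_zero_iff two_ne_zero, R.2.2.2, hR, mul_comm, Real.sin_int_mul_pi, sq, mul_zero]
  exact Subtype.ext (Prod.ext (hP.trans hQ.symm) ((haxis hP).trans (haxis hQ).symm))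

lemma isPreconnected_fst_lt (n : ℕ) (a : ℝ) : IsPreconnected {Q : necklace n | Q.1.1 < a} := by
  have himage : curve n '' (Icc (-n : ℝ) n ∩ Ioo (-a) a) = {Q : necklace n | Q.1.1 < a} := by
    ext Q
    constructor
    · rintro ⟨u, ⟨hu, hua⟩, rfl⟩
      exact (curve_fst (abs_le.2 hu)).trans_lt (abs_lt.2 hua)
    · intro hQ
      obtain ⟨u, hu, rfl⟩ := exists_curve_eq Q
      exact ⟨u, ⟨abs_le.1 (hu.trans_le (curve n u).2.2.1), abs_lt.1 (hu.trans_lt hQ)⟩, rfl⟩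
  exact himage ▸ (ordConnected_Icc.inter ordConnected_Ioo).isPreconnected.image _
    (continuous_curve n).continuousOn

lemma isPreconnected_lt_fst (n : ℕ) (a : ℝ) : IsPreconnected {Q : necklace n | a < Q.1.1} := by
  have hpre : mirror n ⁻¹' {Q | Q.1.1 < n - a} = {Q : necklace n | a < Q.1.1} := by
    ext Q
    simp [mirror_fst]
  exact hpre ▸ (mirror n).isPreconnected_preimage.2 (isPreconnected_fst_lt n (n - a))

lemma compl_singleton_of_fst_eq {P : necklace n} {m : ℤ} (hP : P.1.1 = m) :
    {P}ᶜ = {Q : necklace n | Q.1.1 ≠ m} := by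
  ext Q
  exact not_congr ⟨fun h => h ▸ hP, fun h => eq_of_fst_eq_intCast h hP⟩

/-- Removing a point of the closed curve that is passed only once leaves two pieces, which share
the base point of the curve. -/
lemma notMem_cutPoints_of_ne_intCast {P : necklace n} (hP : ∀ m : ℤ, P.1.1 ≠ m) :
    P ∉ cutPoints (necklace n) := by
  obtain ⟨u, hu, rfl⟩ := exists_curve_eq P
  have hun : |u| < n := lt_of_le_of_ne (hu ▸ (curve n u).2.2.1) (hu ▸ mod_cast hP n)
  have hint (m : ℤ) : u ≠ m := fun h => hP |m| (by rw [← hu, h, Int.cast_abs])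
  have hinj {w : ℝ} (hw : |w| ≤ n) (h : curve n w = curve n u) : w = u :=
    (((curve_eq_curve_iff hun.le hw).1 h.symm).resolve_right fun h => h.2.elim hint).symm
  have himage : {curve n u}ᶜ = curve n '' Ico (-n : ℝ) u ∪ curve n '' Ioc u n := by
    rw [← image_union]
    ext Q
    constructor
    · intro hQ
      obtain ⟨w, hw, rfl⟩ : Q ∈ curve n '' Icc (-n : ℝ) n := curve_image_Icc ▸ mem_univ Q
      rcases lt_trichotomy w u with h | rfl | h
      · exact ⟨w, .inl ⟨hw.1, h⟩, rfl⟩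
      · exact absurd rfl hQ
      · exact ⟨w, .inr ⟨h, hw.2⟩, rfl⟩
    · rintro ⟨w, ⟨hw, hwu⟩ | ⟨huw, hw⟩, rfl⟩ h
      · exact hwu.ne (hinj (abs_le.2 ⟨hw, hwu.le.trans (abs_lt.1 hun).2.le⟩) h)
      · exact huw.ne' (hinj (abs_le.2 ⟨(abs_lt.1 hun).1.le.trans huw.le, hw⟩) h)
  rw [cutPoints, mem_ofPred_eq, not_not, himage]
  refine IsPreconnected.union (curve n n) ⟨-n, ⟨le_rfl, (abs_lt.1 hun).1⟩, ?_⟩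
    ⟨n, ⟨(abs_lt.1 hun).2, le_rfl⟩, rfl⟩ ?_ ?_
  · simpa using curve_neg (n := n) (m := n) (by simp)
  · exact isPreconnected_Ico.image _ (continuous_curve n).continuousOn
  · exact isPreconnected_Ioc.image _ (continuous_curve n).continuousOn

lemma mem_cutPoints_of_fst_eq {P : necklace n} {m : ℤ} (h0 : 0 < m) (hn : m < n)
    (hP : P.1.1 = m) : P ∈ cutPoints (necklace n) := by
  intro hconn
  rw [compl_singleton_of_fst_eq hP] at hconn
  have hfst0 : (curve n 0).1.1 = 0 := by simp [curve_fst]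
  have hfstn : (curve n n).1.1 = n := by simp [curve_fst]
  have hlt : (curve n n).1.1 < m := lt_of_isPreconnected (x := curve n 0) continuous_fst_val hconn
    (fun _ hQ => hQ) (by rw [mem_ofPred_eq, hfst0]; exact_mod_cast h0.ne)
    (by rw [mem_ofPred_eq, hfstn]; exact_mod_cast hn.ne') (by rw [hfst0]; exact_mod_cast h0)
  rw [hfstn] at hlt
  exact hn.not_gt (mod_cast hlt)

lemma mem_cutPoints_iff {P : necklace n} :
    P ∈ cutPoints (necklace n) ↔ ∃ m : ℤ, 0 < m ∧ m < n ∧ P.1.1 = m := by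
  refine ⟨fun hcut => ?_, fun ⟨m, h0, hn, hP⟩ => mem_cutPoints_of_fst_eq h0 hn hP⟩
  obtain ⟨m, hP⟩ : ∃ m : ℤ, P.1.1 = m := by
    by_contra! hP
    exact notMem_cutPoints_of_ne_intCast hP hcut
  have h0 : 0 ≤ m := Int.cast_nonneg_iff.1 (hP ▸ P.2.1)
  have hn : m ≤ n := mod_cast hP.symm.trans_le P.2.2.1
  refine ⟨m, h0.lt_of_ne' ?_, hn.lt_of_ne ?_, hP⟩ <;> rintro rfl <;> refine hcut ?_ <;>
    rw [compl_singleton_of_fst_eq hP]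
  · convert isPreconnected_lt_fst n 0 using 3 with Q
    simpa using ne_comm.trans Q.2.1.lt_iff_ne.symm
  · convert isPreconnected_fst_lt n n using 3 with Q
    simpa using Q.2.2.1.lt_iff_ne.symm

lemma connectedComponentIn_compl_singleton {P Q : necklace n} {m : ℤ} (hP : P.1.1 = m)
    (hQ : Q.1.1 < m) : connectedComponentIn {P}ᶜ Q = {R : necklace n | R.1.1 < m} := by
  rw [compl_singleton_of_fst_eq hP]
  exact connectedComponentIn_eq_setOf_lt continuous_fst_val (fun _ hR => hR)
    (fun _ hR => ne_of_lt hR) (isPreconnected_fst_lt n m) hQ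

lemma ncard_cutPoints_inter_fst_lt {m : ℤ} (hm : 0 < m) (hmn : m ≤ n) :
    (cutPoints (necklace n) ∩ {Q | Q.1.1 < m}).ncard = m - 1 := by
  have hfst {k : ℤ} (hk : k ∈ Ioo 0 m) : (curve n k).1.1 = k := by
    have habs : |(k : ℝ)| = k := abs_of_nonneg (mod_cast hk.1.le)
    rw [curve_fst (habs.trans_le (mod_cast hk.2.le.trans hmn)), habs]
  have himage : (fun k : ℤ => curve n k) '' Ioo 0 m =
      cutPoints (necklace n) ∩ {Q | Q.1.1 < m} := by
    ext Q
    rw [mem_inter_iff, mem_cutPoints_iff]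
    constructor
    · rintro ⟨k, hk, rfl⟩
      exact ⟨⟨k, hk.1, hk.2.trans_le hmn, hfst hk⟩, (hfst hk).trans_lt (mod_cast hk.2)⟩
    · rintro ⟨⟨k, hk, -, hQ⟩, hQm : Q.1.1 < m⟩
      have hkm : k ∈ Ioo 0 m := ⟨hk, mod_cast hQ.symm.trans_lt hQm⟩
      exact ⟨k, hkm, eq_of_fst_eq_intCast (hfst hkm) hQ⟩
  have hinj : InjOn (fun k : ℤ => curve n k) (Ioo 0 m) := fun k hk l hl h => by
    exact_mod_cast (hfst hk).symm.trans ((congrArg (fun Q => Q.1.1) h).trans (hfst hl))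
  rw [← himage, hinj.ncard_image, ← Finset.coe_Ioo, ncard_coe_finset, Int.card_Ioo]
  omega

lemma cutCount_of_fst_lt {P Q : necklace n} {m : ℤ} (h0 : 0 < m) (hn : m ≤ n) (hP : P.1.1 = m)
    (hQ : Q.1.1 < m) : cutCount P Q = m - 1 := by
  rw [cutCount, connectedComponentIn_compl_singleton hP hQ, ncard_cutPoints_inter_fst_lt h0 hn]

lemma mem_cutRegion_of_fst_lt {m : ℤ} {Q : necklace n} (h0 : 0 < m) (hn : m < n)
    (hQ : Q.1.1 < m) : Q ∈ cutRegion (necklace n) m := by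
  have habs : |(m : ℝ)| = m := abs_of_nonneg (mod_cast h0.le)
  have hfst : (curve n m).1.1 = m := by rw [curve_fst (habs.trans_le (mod_cast hn.le)), habs]
  refine ⟨curve n m, mem_cutPoints_of_fst_eq h0 hn hfst, fun h => (h ▸ hQ).ne hfst, ?_⟩
  exact (cutCount_of_fst_lt h0 hn.le hfst hQ).trans_lt (sub_one_lt m)

lemma fst_lt_of_cutCount_lt {P Q : necklace n} {j m : ℤ} (h0 : 0 < j) (hn : j ≤ n)
    (hP : P.1.1 = j) (hQ : Q.1.1 < j) (hcount : cutCount P Q < m) : Q.1.1 < m := by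
  rw [cutCount_of_fst_lt h0 hn hP hQ, Int.sub_one_lt_iff] at hcount
  exact hQ.trans_le (mod_cast hcount)

lemma depth_lt_iff_mem_cutRegion {m : ℤ} {Q : necklace n} (h0 : 0 < m) (hn : m < n) :
    depth Q < m ↔ Q ∈ cutRegion (necklace n) m := by
  rw [depth, min_lt_iff, ← mirror_fst]
  constructor
  · rintro (hQ | hQ)
    · exact mem_cutRegion_of_fst_lt h0 hn hQ
    · exact (apply_mem_cutRegion_iff (mirror n)).1 (mem_cutRegion_of_fst_lt h0 hn hQ)
  · rintro ⟨P, hPcut, hQP, hcount⟩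
    obtain ⟨j, hj0, hjn, hP⟩ := mem_cutPoints_iff.1 hPcut
    rcases lt_trichotomy Q.1.1 j with hQ | hQ | hQ
    · exact .inl (fst_lt_of_cutCount_lt hj0 hjn.le hP hQ hcount)
    · exact absurd (eq_of_fst_eq_intCast hQ hP) hQP
    · refine .inr (fst_lt_of_cutCount_lt (P := mirror n P) (j := n - j) (by omega) (by omega) ?_ ?_
        ((cutCount_apply (mirror n) hQP).symm ▸ hcount))
      · push_cast
        rw [mirror_fst, hP]
      · push_cast
        rw [mirror_fst]
        linarith

lemma depth_apply_lt_iff (h : necklace n ≃ₜ necklace n) {m : ℤ} (h0 : 0 < m) (Q : necklace n) :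
    depth (h Q) < m ↔ depth Q < m := by
  rcases lt_or_ge m n with hn | hn
  · rw [depth_lt_iff_mem_cutRegion h0 hn, depth_lt_iff_mem_cutRegion h0 hn,
      apply_mem_cutRegion_iff]
  · have hlt (R : necklace n) : depth R < m := by
      have h0' : (0 : ℝ) < m := mod_cast h0
      have hn' : (n : ℝ) ≤ m := mod_cast hn
      linarith [(depth_mem_Icc R).2]
    exact iff_of_true (hlt _) (hlt _)

lemma mem_cutPoints_iff_depth {Q : necklace n} :
    Q ∈ cutPoints (necklace n) ↔ ∃ m : ℤ, 0 < m ∧ depth Q = m := by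
  rw [mem_cutPoints_iff]
  constructor
  · rintro ⟨m, h0, hn, hQ⟩
    exact ⟨min m (n - m), lt_min h0 (sub_pos.2 hn), by rw [depth, hQ]; push_cast; rfl⟩
  · rintro ⟨m, h0, hQ⟩
    have hn : m < n := by
      have h0' : (0 : ℝ) < m := mod_cast h0
      have hhalf : (m : ℝ) ≤ n / 2 := hQ ▸ (depth_mem_Icc Q).2
      exact_mod_cast (by linarith : (m : ℝ) < n)
    rcases min_choice Q.1.1 (n - Q.1.1) with h | h <;> rw [← depth, hQ] at h
    · exact ⟨m, h0, hn, h.symm⟩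
    · exact ⟨n - m, sub_pos.2 hn, sub_lt_self _ h0, by push_cast; linarith⟩

lemma depth_apply_eq_iff (h : necklace n ≃ₜ necklace n) {m : ℤ} (h0 : 0 < m) (Q : necklace n) :
    depth (h Q) = m ↔ depth Q = m := by
  have hiff (R : necklace n) : depth R = m ↔
      R ∈ cutPoints (necklace n) ∧ ¬ depth R < m ∧ depth R < (m + 1 : ℤ) := by
    rw [mem_cutPoints_iff_depth]
    constructor
    · intro hR
      exact ⟨⟨m, h0, hR⟩, hR.not_lt, hR.trans_lt (mod_cast lt_add_one m)⟩
    · rintro ⟨⟨k, -, hk⟩, hge, hlt⟩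
      rw [hk, Int.cast_lt] at hge hlt
      rw [hk, show k = m by omega]
  rw [hiff, hiff, apply_mem_cutPoints_iff, depth_apply_lt_iff h h0,
    depth_apply_lt_iff h (h0.trans (lt_add_one m))]

/-- As `rescale 0 s = max s (1 / 2)`, only the comparisons with positive integers matter. -/
lemma stratum_rescale_zero_depth_apply (h : necklace n ≃ₜ necklace n) (Q : necklace n) :
    stratum (rescale 0 (depth (h Q))) = stratum (rescale 0 (depth Q)) := by
  have hpos {m : ℤ} (hm : (1 / 2 : ℝ) ≤ m) : 0 < m := by
    exact_mod_cast (by norm_num : (0 : ℝ) < 1 / 2).trans_le hm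
  simp only [rescale_zero_left]
  refine stratum_congr (fun m => ?_) fun m => ?_
  · simp only [max_lt_iff]
    exact and_congr_left fun hm => depth_apply_lt_iff h (hpos hm.le) Q
  · simp only [max_le_iff, le_iff_lt_or_eq (a := depth _)]
    exact and_congr_left fun hm =>
      or_congr (depth_apply_lt_iff h (hpos hm) Q) (depth_apply_eq_iff h (hpos hm) Q)

end Cut

section Level

/-- The level of a point of the necklace: the index of the stratum of its rescaled depth. -/
noncomputable def level (e : ℕ) (Q : necklace n) : ℤ := stratum (rescale e (depth Q))

lemma encard_range_level (hn : 0 < n) (e : ℕ) :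
    (range (level e : necklace n → ℤ)).encard = (n + e : ℕ) := by
  have hhalf : (1 / 2 : ℝ) ≤ n / 2 := by
    gcongr
    exact_mod_cast hn
  have hrange : range (level e : necklace n → ℤ) = Icc (1 - e : ℤ) n := by
    calc range (level e : necklace n → ℤ)
        = stratum '' (rescale e '' range (depth : necklace n → ℝ)) := by
          rw [← range_comp, ← range_comp]; rfl
      _ = stratum '' Icc ((1 - e) / 2 : ℝ) (n / 2) := by
          rw [range_depth, rescale_image_Icc e hhalf]
      _ = Icc (1 - e : ℤ) n := by
          rw [← stratum_image_Icc]; push_cast; rfl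
  rw [hrange, ← Finset.coe_Icc, encard_coe_eq_coe_finsetCard, Int.card_Icc]
  congr 1
  omega

lemma encard_range_level_le_invariantHeight_add_one {G : Type*} [Group G] [MulAction G (necklace n)]
    {e : ℕ} (hinv : ∀ (g : G) (Q : necklace n), level e (g • Q) = level e Q) :
    (range (level e : necklace n → ℤ)).encard ≤
      invariantHeight G (univ : Set (necklace n)) + 1 :=
  encard_range_stratum_le_invariantHeight_add_one
    ((continuous_rescale e).comp continuous_depth) hinv

variable {e : ℕ} {m : ℤ}

/-- The parameters, other than the end points `±n`, of the points of one-dimensional level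
`2 * m + 1`. -/
def levelParameters (n e : ℕ) (m : ℤ) : Set ℝ :=
  {u | |u| < n ∧ rescale e (min |u| (n - |u|)) ∈ Ioo (m : ℝ) (m + 1)}

lemma isOpen_levelParameters : IsOpen (levelParameters n e m) := by
  have hcont : Continuous fun u : ℝ => rescale e (min |u| (n - |u|)) :=
    (continuous_rescale e).comp (by fun_prop)
  exact (isOpen_lt continuous_abs continuous_const).inter (isOpen_Ioo.preimage hcont)

lemma level_of_mem_image {Q : necklace n} (hQ : Q ∈ curve n '' levelParameters n e m) :
    level e Q = 2 * m + 1 := by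
  obtain ⟨u, hu, rfl⟩ := hQ
  rw [level, depth_curve hu.1.le]
  exact stratum_of_mem_Ioo hu.2

lemma mem_levelParameters_of_mem_Icc (hn : 0 < n) {s : ℝ} (hs : s ∈ Icc (0 : ℝ) (n / 2))
    (h : rescale e s ∈ Ioo (m : ℝ) (m + 1)) : s ∈ levelParameters n e m := by
  have hn' : (0 : ℝ) < n := mod_cast hn
  have habs : |s| = s := abs_of_nonneg hs.1
  refine ⟨by linarith [hs.2], ?_⟩
  rwa [habs, min_eq_left (by linarith [hs.2])]

/-- The curve doubles only integer parameters, and the nonzero ones other than `±n` have positive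
integer depth, which `rescale` fixes. -/
lemma eq_of_curve_eq_of_mem_levelParameters {u v : ℝ} (hu : u ∈ levelParameters n e m)
    (h : curve n u = curve n v) : u = v := by
  obtain ⟨w, hw, hvw, hlt⟩ := exists_abs_le_curve_eq_curve (n := n) v
  rcases (curve_eq_curve_iff hu.1.le hw).1 (h.trans hvw) with rfl | ⟨huw, k, rfl⟩
  · exact (hlt hu.1).symm
  · rw [hlt (by rw [← abs_neg, ← huw]; exact hu.1), huw, neg_eq_self]
    suffices hk : k = 0 by rw [← neg_eq_zero, ← huw, hk, Int.cast_zero]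
    by_contra hk
    obtain ⟨hkn, hmem⟩ := hu
    have hcast : min |(k : ℝ)| (n - |(k : ℝ)|) = (min |k| (n - |k|) : ℤ) := by push_cast; rfl
    have hkn' : |k| < n := mod_cast hkn
    have hone : 1 ≤ min |k| (n - |k|) := le_min (Int.one_le_abs hk) (by omega)
    have hhalf : (1 / 2 : ℝ) ≤ (min |k| (n - |k|) : ℤ) :=
      (by norm_num : (1 / 2 : ℝ) ≤ 1).trans (mod_cast hone)
    rw [hcast, rescale_of_ge hhalf] at hmem
    have h₁ : m < min |k| (n - |k|) := mod_cast hmem.1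
    have h₂ : min |k| (n - |k|) < m + 1 := mod_cast hmem.2
    omega

lemma exists_fibrePreserving_level_curve (hn : 0 < n) {s t : ℝ} (hs : s ∈ Icc (0 : ℝ) (n / 2))
    (ht : t ∈ Icc (0 : ℝ) (n / 2)) (hsm : rescale e s ∈ Ioo (m : ℝ) (m + 1))
    (htm : rescale e t ∈ Ioo (m : ℝ) (m + 1)) :
    ∃ g ∈ fibrePreserving (level e : necklace n → ℤ), g (curve n s) = curve n t := by
  have hsub : uIcc s t ⊆ levelParameters n e m := fun u hu =>
    mem_levelParameters_of_mem_Icc hn (ordConnected_Icc.uIcc_subset hs ht hu)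
      ((ordConnected_Ioo.preimage_mono (monotone_rescale e)).uIcc_subset hsm htm hu)
  obtain ⟨g, hg, hoff⟩ := exists_homeomorph_of_isPreconnected (isQuotientMap_curve n)
    isOpen_levelParameters (fun u hu v => eq_of_curve_eq_of_mem_levelParameters hu)
    isPreconnected_uIcc hsub left_mem_uIcc right_mem_uIcc
  refine ⟨g, fun Q => ?_, hg⟩
  by_cases hQ : Q ∈ curve n '' levelParameters n e m
  · have hgQ : g Q ∈ curve n '' levelParameters n e m := by
      by_contra h
      exact h ((g.injective (hoff _ h)).symm ▸ hQ)
    rw [level_of_mem_image hQ, level_of_mem_image hgQ]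
  · rw [hoff Q hQ]

lemma fibrePreserving_depth_le_level (n e : ℕ) :
    fibrePreserving (depth : necklace n → ℝ) ≤ fibrePreserving (level e) :=
  fun _ hg Q => congrArg (fun d => stratum (rescale e d)) (hg Q)

lemma exists_fibrePreserving_level (hn : 0 < n) {P Q : necklace n} (h : level e P = level e Q) :
    ∃ g ∈ fibrePreserving (level e : necklace n → ℤ), g P = Q := by
  obtain ⟨m, ⟨hP, hQ⟩ | ⟨hP, hQ⟩⟩ := eq_intCast_or_mem_Ioo_of_stratum_eq h
  · have hne : rescale e (depth Q) ≠ 1 / 2 := fun hhalf => by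
      have h2 : (2 * m : ℝ) = 1 := by linarith [hQ.symm.trans hhalf]
      have : 2 * m = 1 := mod_cast h2
      omega
    obtain ⟨g, hg, hgPQ⟩ := exists_fibrePreserving_depth (eq_of_rescale_eq (hP.trans hQ.symm) hne)
    exact ⟨g, fibrePreserving_depth_le_level n e hg, hgPQ⟩
  · have hcurve (R : necklace n) : depth R = depth (curve n (depth R)) :=
      (depth_curve_of_mem_Icc (depth_mem_Icc R)).symm
    obtain ⟨g₁, hg₁, h₁⟩ := exists_fibrePreserving_depth (hcurve P)
    obtain ⟨g₂, hg₂, h₂⟩ := exists_fibrePreserving_depth (hcurve Q).symm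
    obtain ⟨g, hg, h⟩ :=
      exists_fibrePreserving_level_curve hn (depth_mem_Icc P) (depth_mem_Icc Q) hP hQ
    have hle := fibrePreserving_depth_le_level n e
    exact ⟨g₂ * (g * g₁), mul_mem (hle hg₂) (mul_mem hg (hle hg₁)),
      ((congrArg g₂ (congrArg g h₁)).trans (congrArg g₂ h)).trans h₂⟩

lemma invariantHeight_fibrePreserving_level (p e : ℕ) :
    invariantHeight (fibrePreserving (level e : necklace (p + 1) → ℤ))
      (univ : Set (necklace (p + 1))) = (p + e : ℕ) := by
  have hcard : (range (level e : necklace (p + 1) → ℤ)).encard = (p + e : ℕ) + 1 := by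
    rw [encard_range_level p.succ_pos, Nat.succ_add, Nat.cast_succ]
  refine ENat.add_left_injective_of_ne_top ENat.one_ne_top ((le_antisymm ?_ ?_).trans hcard)
  · refine invariantHeight_add_one_le_encard_range fun P Q h => ?_
    obtain ⟨g, hg, hgP⟩ := exists_fibrePreserving_level p.succ_pos h
    exact ⟨⟨g, hg⟩, hgP⟩
  · exact encard_range_level_le_invariantHeight_add_one fun g Q => g.2 Q

end Level

end necklace

theorem mainTheorem1 (p : ℕ) :
    ∃ (X : Type) (_ : MetricSpace X), IsTopologicalGraph X ∧
      possibleHeights X = {h : ℕ∞ | ∃ k : ℕ, p ≤ k ∧ h = (k : ℕ∞)} ∪ {⊤} := by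
  refine ⟨necklace (p + 1), inferInstance, necklace.isTopologicalGraph p.succ_pos,
    Subset.antisymm ?_ ?_⟩
  · rintro _ ⟨G, _, _, _, _, _, rfl⟩
    have hle := necklace.encard_range_level_le_invariantHeight_add_one (G := G) (e := 0)
      fun g => necklace.stratum_rescale_zero_depth_apply
        (Homeomorph.smul (α := necklace (p + 1)) g)
    rw [necklace.encard_range_level p.succ_pos] at hle
    generalize invariantHeight G (univ : Set (necklace (p + 1))) = h at hle ⊢
    induction h with
    | top => exact .inr rfl
    | coe k => exact .inl ⟨k, Nat.succ_le_succ_iff.1 (mod_cast hle), rfl⟩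
  · rintro _ (⟨_, hk, rfl⟩ | rfl)
    · obtain ⟨e, rfl⟩ := Nat.exists_eq_add_of_le hk
      rw [← necklace.invariantHeight_fibrePreserving_level]
      exact invariantHeight_mem_possibleHeights _
    · refine top_mem_possibleHeights necklace.continuous_depth ?_
      rw [necklace.range_depth]
      exact Icc_infinite (by positivity)
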